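/- For a probability measure $P$ on a measurable space $\mathcal X$, a measurable $\ell:\mathcal X\to[0,\infty)$ and $\delta\in(0,1]$, let $$\mathrm{Quantile}(1-\delta;P,\ell):=\inf\{r\in[0,\infty): P(\ell\le r)\ge 1-\delta\}.$$ Let $n,d\ge 1$ be integers, let $\Sigma\in\mathbb R^{d\times d}$ be symmetric positive definite, and for $\theta\in\mathbb R^d$ let $P_\theta:=\mathsf N_d(\theta,\Sigma)^{\otimes n}$ be the law of $n$ independent $\mathsf N_d(\theta,\Sigma)$ random vectors $X=(X_1,\dots,X_n)$. The minimax $(1-\delta)$th quantile for estimating $\theta$ under squared Euclidean loss is $$\mathcal M(\delta):=\inf_{\widehat\theta}\ \sup_{\theta\in\mathbb R^d}\ \mathrm{Quantile}\bigl(1-\delta;P_\theta,\|\widehat\theta(X)-\theta\|_2^2\bigr),$$ where the infimum is over all measurable functions $\widehat\theta:(\mathbb R^d)^n\to\mathbb R^d$. **Proposition.** There exist universal constants $c,C>0$ such that for all integers $n,d\ge1$, all $\delta\in(0,1/4]$ and all symmetric positive definite $\Sigma\in\mathbb R^{d\times d}$, $$c\left(\frac{\mathrm{tr}(\Sigma)}{n}+\frac{\|\Sigma\|_{\mathrm{op}}\log(1/\delta)}{n}\right)\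 \le\ \mathcal M(\delta)\ \le\ C\left(\frac{\mathrm{tr}(\Sigma)}{n}+\frac{\|\Sigma\|_{\mathrm{op}}\log(1/\delta)}{n}\right).$$ Moreover, the upper bound is attained by the sample mean $\bar X:=n^{-1}\sum_{i=1}^nX_i$, that is, $$\sup_{\theta\in\mathbb R^d}\mathrm{Quantile}\bigl(1-\delta;P_\theta,\|\bar X-\theta\|_2^2\bigr)\ \le\ C\left(\frac{\mathrm{tr}(\Sigma)}{n}+\frac{\|\Sigma\|_{\mathrm{op}}\log(1/\delta)}{n}\right).$$ -/

import Mathlib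

open MeasureTheory ProbabilityTheory
open scoped ENNReal NNReal

namespace MinimaxQuantile

noncomputable section

/-- The `(1 - δ)`th quantile of a (nonnegative) loss `ℓ` under `P`:
`inf {r ∈ [0, ∞) : P (ℓ ≤ r) ≥ 1 - δ}`, with values in `[0, ∞]` (the infimum of the empty set
is `∞`). -/
def quantile {X : Type*} [MeasurableSpace X] (δ : ℝ) (P : Measure X) (ℓ : X → ℝ) : ℝ≥0∞ :=
  ⨅ (r : ℝ≥0) (_ : ENNReal.ofReal (1 - δ) ≤ P {x | ℓ x ≤ r}), (r : ℝ≥0∞)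

/-- The worst case over `θ` and over `P ∈ Ps θ` of the `(1 - δ)`th quantile of the loss of an
estimator `T`. -/
def worstQuantile {X Θ : Type*} [MeasurableSpace X] (δ : ℝ)
    (Ps : Θ → Set (Measure X)) (L : Θ → Θ → ℝ) (T : X → Θ) : ℝ≥0∞ :=
  ⨆ (θ : Θ), ⨆ P ∈ Ps θ, quantile δ P (fun x => L (T x) θ)

/-- The minimax `(1 - δ)`th quantile of the loss `L` over the family `Ps`: the infimum of the
worst-case quantile over all measurable estimators. -/
def minimaxQuantile {X Θ : Type*} [MeasurableSpace X] [MeasurableSpace Θ] (δ : ℝ)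
    (Ps : Θ → Set (Measure X)) (L : Θ → Θ → ℝ) : ℝ≥0∞ :=
  ⨅ (T : X → Θ) (_ : Measurable T), worstQuantile δ Ps L T

/-- The Gaussian location model: for each mean `θ`, the single distribution of `n` independent
observations from the normal law with mean `θ` and covariance matrix `S`. -/
def gaussianModel {d : ℕ} (n : ℕ) (S : Matrix (Fin d) (Fin d) ℝ) :
    EuclideanSpace ℝ (Fin d) → Set (Measure (Fin n → EuclideanSpace ℝ (Fin d))) :=
  fun θ => {Measure.pi (fun _ : Fin n => multivariateGaussian θ S)}

/-- Squared Euclidean loss. -/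
def sqLoss {d : ℕ} (θ₁ θ₂ : EuclideanSpace ℝ (Fin d)) : ℝ := ‖θ₁ - θ₂‖ ^ 2

/-- The sample mean. -/
def sampleMean {d : ℕ} (n : ℕ) (x : Fin n → EuclideanSpace ℝ (Fin d)) :
    EuclideanSpace ℝ (Fin d) :=
  (n : ℝ)⁻¹ • ∑ i, x i

/-- `tr S / n + ‖S‖_op log (1 / δ) / n`, where `‖S‖_op` is the norm of `S` as an operator on
Euclidean space. -/
def gaussianRate {d : ℕ} (n : ℕ) (S : Matrix (Fin d) (Fin d) ℝ) (δ : ℝ) : ℝ :=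
  S.trace / n + ‖Matrix.toEuclideanCLM (𝕜 := ℝ) S‖ * Real.log (1 / δ) / n

end

end MinimaxQuantile

/-!
The rate is governed by the law of the mean noise `ε̄`, which is centred Gaussian with covariance
`S / n`.

*Upper bound.* The error of the sample mean is `ε̄`. In an eigenbasis of the covariance its
coordinates are independent Gaussians (`map_eigenvectorBasis_multivariateGaussian`), so the
exponential moments of `‖ε̄‖ ^ 2` are explicit
(`integral_exp_mul_norm_sq_multivariateGaussian`), and Chernoff's bound gives the tail bound
`multivariateGaussian_real_norm_sq_ge_le`.

*Lower bound.* Draw `θ` at random with the law of `ε̄`, independently of the noise. The map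
`(θ, ε) ↦ (ε̄, ε - ε̄ + θ)` preserves the joint law (`measurePreserving_swapCLM`) and leaves every
observation `θ + ε i` unchanged, so the observations cannot tell `θ` from `ε̄`. An estimator with
squared loss at most `R` with probability at least `1 - δ` is therefore close to both, and the
triangle inequality gives `‖θ - ε̄‖ ^ 2 ≤ 4 R` with probability at least `1 - 2 δ`
(`multivariateGaussian_real_le_of_forall_loss_le`). As `θ - ε̄` is centred Gaussian with covariance
`2 S / n`, its small ball probabilities force `R` to be at least of order `tr S / n`
(`multivariateGaussian_real_norm_sq_le_lt_half`, which uses `δ ≤ 1 / 4`), and its tail in the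
direction of the largest eigenvalue forces `R` to be at least of order `‖S‖ log (1 / δ) / n`
(`exp_neg_div_eight_le_multivariateGaussian_real`).
-/

namespace MinimaxQuantile

open Matrix RealInnerProductSpace

/-! ### Gaussian integrals of quadratic exponentials -/

theorem integral_exp_mul_sq_gaussianReal {v : ℝ≥0} (hv : v ≠ 0) {t : ℝ} (ht : 2 * t * v < 1) :
    ∫ x, Real.exp (t * x ^ 2) ∂(gaussianReal 0 v) = (√(1 - 2 * t * v))⁻¹ := by
  have hv' : (0 : ℝ) < v := lt_of_le_of_ne v.2 (by exact_mod_cast hv.symm)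
  rw [integral_gaussianReal_eq_integral_smul hv]
  have h (x : ℝ) : gaussianPDFReal 0 v x • Real.exp (t * x ^ 2) =
      (√(2 * Real.pi * v))⁻¹ * Real.exp (-((1 - 2 * t * v) / (2 * v)) * x ^ 2) := by
    rw [gaussianPDFReal_def, smul_eq_mul, mul_assoc, ← Real.exp_add]
    congr 2
    field_simp
    ring
  simp_rw [h]
  rw [integral_const_mul, integral_gaussian, ← Real.sqrt_inv, ← Real.sqrt_inv,
    ← Real.sqrt_mul (by positivity)]
  congr 1
  have : (1 - 2 * t * v : ℝ) ≠ 0 := by linarith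
  have := Real.pi_pos.ne'
  field_simp

/-- A weak form of the Gaussian lower tail bound. With `s = √v`, the density is at least
`exp (-(t + s) ^ 2 / (2 v)) / √(2πv)` on `(t, t + s]`, and `(t + s) ^ 2 ≤ 2 t ^ 2 + 2 v`. The
constant satisfies `√(2π) e ≤ 8`. -/
theorem exp_neg_sq_div_eight_le_gaussianReal_Ioi {v : ℝ≥0} (hv : v ≠ 0) {t : ℝ} (ht : 0 ≤ t) :
    Real.exp (-t ^ 2 / v) / 8 ≤ (gaussianReal 0 v).real (Set.Ioi t) := by
  have hv' : (0 : ℝ) < v := lt_of_le_of_ne v.2 (by exact_mod_cast hv.symm)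
  set s := √(v : ℝ)
  have hs : 0 < s := Real.sqrt_pos.2 hv'
  have hs2 : s ^ 2 = v := Real.sq_sqrt hv'.le
  have hpi : √(2 * Real.pi) * Real.exp 1 ≤ 8 := by
    have h1 : √(2 * Real.pi) ≤ 2.6 := by
      apply Real.sqrt_le_iff.2
      refine ⟨by norm_num, ?_⟩
      have := Real.pi_lt_d2
      norm_num at this ⊢
      linarith
    have h2 := Real.exp_one_lt_d9
    nlinarith [Real.exp_pos 1]
  have hsub : Set.Ioc t (t + s) ⊆ Set.Ioi t := fun x hx => hx.1
  refine le_trans ?_ (measureReal_mono hsub)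
  rw [measureReal_def, gaussianReal_apply_eq_integral _ hv,
    ENNReal.toReal_ofReal (integral_nonneg fun x => gaussianPDFReal_nonneg _ _ _)]
  have hconst : ∫ x in Set.Ioc t (t + s),
      (√(2 * Real.pi * v))⁻¹ * Real.exp (-t ^ 2 / v - 1) ≤
      ∫ x in Set.Ioc t (t + s), gaussianPDFReal 0 v x := by
    refine setIntegral_mono_on (integrableOn_const (by simp))
      (integrable_gaussianPDFReal 0 v).integrableOn measurableSet_Ioc fun x hx => ?_
    rw [gaussianPDFReal_def]
    refine mul_le_mul_of_nonneg_left (Real.exp_le_exp.2 ?_) (by positivity)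
    rw [sub_zero, div_sub_one hv'.ne', div_le_div_iff₀ hv' (by positivity), ← hs2]
    have hx2 : x ^ 2 ≤ (t + s) ^ 2 := by
      have := hx.1; have := hx.2
      gcongr
      linarith
    have : x ^ 2 ≤ 2 * t ^ 2 + 2 * s ^ 2 := by nlinarith [sq_nonneg (t - s)]
    nlinarith [sq_nonneg s]
  refine le_trans ?_ hconst
  rw [setIntegral_const, measureReal_def, Real.volume_Ioc, add_sub_cancel_left,
    ENNReal.toReal_ofReal hs.le, smul_eq_mul, Real.sqrt_mul (by positivity), Real.exp_sub]
  change _ ≤ s * ((_ * s)⁻¹ * _)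
  have h2 : 0 < √(2 * Real.pi) := by positivity
  have h3 := Real.exp_pos 1
  have : s * ((√(2 * Real.pi) * s)⁻¹ * (Real.exp (-t ^ 2 / ↑v) / Real.exp 1)) =
      Real.exp (-t ^ 2 / v) / (√(2 * Real.pi) * Real.exp 1) := by
    field_simp
  rw [this]
  gcongr

/-! ### Centred Gaussian vectors in an eigenbasis of the covariance matrix -/

section Spectral

variable {ι : Type*} [Fintype ι] [DecidableEq ι] {S : Matrix ι ι ℝ}

theorem inner_eigenvectorBasis_toEuclideanCLM (hS : S.IsHermitian) (i : ι)
    (x : EuclideanSpace ℝ ι) :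
    ⟪hS.eigenvectorBasis i, toEuclideanCLM (𝕜 := ℝ) S x⟫ =
      hS.eigenvalues i * ⟪hS.eigenvectorBasis i, x⟫ := by
  have h (j : ι) : toEuclideanCLM (𝕜 := ℝ) S (hS.eigenvectorBasis j) =
      hS.eigenvalues j • hS.eigenvectorBasis j := by
    ext k
    have := congrFun (hS.mulVec_eigenvectorBasis j) k
    simpa using this
  conv_lhs => rw [← hS.eigenvectorBasis.sum_repr' x, map_sum]
  simp only [map_smul, h, inner_sum, inner_smul_right, hS.eigenvectorBasis.inner_eq_ite]
  simp [mul_comm]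

theorem dotProduct_mulVec_eq_sum_eigenvalues (hS : S.IsHermitian) (x : EuclideanSpace ℝ ι) :
    x ⬝ᵥ S *ᵥ x = ∑ i, hS.eigenvalues i * ⟪hS.eigenvectorBasis i, x⟫ ^ 2 := by
  rw [← inner_toEuclideanCLM, ← hS.eigenvectorBasis.sum_inner_mul_inner]
  refine Finset.sum_congr rfl fun i _ => ?_
  rw [inner_eigenvectorBasis_toEuclideanCLM, real_inner_comm]
  ring

theorem eigenvalues_le_norm_toEuclideanCLM (hS : S.IsHermitian) (i : ι) :
    hS.eigenvalues i ≤ ‖toEuclideanCLM (𝕜 := ℝ) S‖ := by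
  have h := inner_eigenvectorBasis_toEuclideanCLM hS i (hS.eigenvectorBasis i)
  have h1 : ‖hS.eigenvectorBasis i‖ = 1 := hS.eigenvectorBasis.norm_eq_one i
  rw [real_inner_self_eq_norm_sq, h1, one_pow, mul_one] at h
  rw [← h]
  refine (real_inner_le_norm _ _).trans ?_
  simpa [h1] using (toEuclideanCLM (𝕜 := ℝ) S).le_opNorm (hS.eigenvectorBasis i)

theorem exists_norm_toEuclideanCLM_eq_eigenvalues [Nonempty ι] (hS : S.PosSemidef) :
    ∃ i, ‖toEuclideanCLM (𝕜 := ℝ) S‖ = hS.1.eigenvalues i := by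
  obtain ⟨i, hi⟩ := Finite.exists_max hS.1.eigenvalues
  refine ⟨i, le_antisymm ?_ (eigenvalues_le_norm_toEuclideanCLM hS.1 i)⟩
  refine ContinuousLinearMap.opNorm_le_bound _ (hS.eigenvalues_nonneg i) fun x => ?_
  refine abs_le_of_sq_le_sq' ?_ (mul_nonneg (hS.eigenvalues_nonneg i) (norm_nonneg x)) |>.2
  rw [mul_pow, ← hS.1.eigenvectorBasis.sum_sq_norm_inner_right,
    ← hS.1.eigenvectorBasis.sum_sq_norm_inner_right x, Finset.mul_sum]
  refine Finset.sum_le_sum fun j _ => ?_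
  rw [inner_eigenvectorBasis_toEuclideanCLM, norm_mul, mul_pow, Real.norm_eq_abs, sq_abs]
  have := hi j
  have := hS.eigenvalues_nonneg j
  gcongr

/-- The coordinates of a centred Gaussian vector in an eigenbasis of its covariance matrix are
independent, and their variances are the eigenvalues. -/
theorem map_eigenvectorBasis_multivariateGaussian (hS : S.PosSemidef) :
    (multivariateGaussian 0 S).map (fun x i => ⟪hS.1.eigenvectorBasis i, x⟫) =
      Measure.pi fun i => gaussianReal 0 (hS.1.eigenvalues i).toNNReal := by
  have hm : Measurable fun (x : EuclideanSpace ℝ ι) i => ⟪hS.1.eigenvectorBasis i, x⟫ := by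
    fun_prop
  have := Measure.isProbabilityMeasure_map (μ := multivariateGaussian 0 S) hm.aemeasurable
  refine charFun_eq_pi_iff.1 fun t => ?_
  have hcomp : WithLp.toLp 2 ∘ (fun (x : EuclideanSpace ℝ ι) i => ⟪hS.1.eigenvectorBasis i, x⟫) =
      hS.1.eigenvectorBasis.repr := by
    ext x i
    simp [OrthonormalBasis.repr_apply_apply]
  rw [Measure.map_map (by fun_prop) hm, hcomp]
  have hchar : charFun ((multivariateGaussian 0 S).map hS.1.eigenvectorBasis.repr) t =
      charFun (multivariateGaussian 0 S) (hS.1.eigenvectorBasis.repr.symm t) := by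
    rw [charFun_apply, charFun_apply, integral_map (by fun_prop) (by fun_prop)]
    congr with x
    rw [← hS.1.eigenvectorBasis.repr.inner_map_map x, LinearIsometryEquiv.apply_symm_apply]
  rw [hchar, charFun_multivariateGaussian hS, dotProduct_mulVec_eq_sum_eigenvalues hS.1]
  simp_rw [charFun_gaussianReal, ← Complex.exp_sum]
  congr 1
  have h (i : ι) : ⟪hS.1.eigenvectorBasis i, hS.1.eigenvectorBasis.repr.symm t⟫ = t i := by
    rw [← OrthonormalBasis.repr_apply_apply, LinearIsometryEquiv.apply_symm_apply]
  simp [h, Finset.sum_div, Real.coe_toNNReal _ (hS.eigenvalues_nonneg _)]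

theorem integral_exp_mul_norm_sq_multivariateGaussian (hS : S.PosDef) {t : ℝ}
    (ht : ∀ i, 2 * t * hS.1.eigenvalues i < 1) :
    ∫ x, Real.exp (t * ‖x‖ ^ 2) ∂(multivariateGaussian 0 S) =
      ∏ i, (√(1 - 2 * t * hS.1.eigenvalues i))⁻¹ := by
  have h (x : EuclideanSpace ℝ ι) : Real.exp (t * ‖x‖ ^ 2) =
      (fun y : ι → ℝ => ∏ i, Real.exp (t * y i ^ 2))
        (fun i => ⟪hS.1.eigenvectorBasis i, x⟫) := by
    simp only [← Real.exp_sum, ← Finset.mul_sum]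
    rw [← hS.1.eigenvectorBasis.sum_sq_norm_inner_right x]
    simp
  simp_rw [h]
  rw [← integral_map (f := fun y : ι → ℝ => ∏ i, Real.exp (t * y i ^ 2)) (by fun_prop)
    (Measurable.aestronglyMeasurable (by fun_prop)),
    map_eigenvectorBasis_multivariateGaussian hS.posSemidef,
    integral_fintype_prod_eq_prod (f := fun _ y => Real.exp (t * y ^ 2))]
  refine Finset.prod_congr rfl fun i _ => ?_
  have hpos := hS.eigenvalues_pos i
  have hc : ((hS.1.eigenvalues i).toNNReal : ℝ) = hS.1.eigenvalues i :=
    Real.coe_toNNReal _ hpos.le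
  rw [integral_exp_mul_sq_gaussianReal (by simpa using hpos), hc]
  rw [hc]; exact ht i

theorem integrable_exp_mul_norm_sq_multivariateGaussian (hS : S.PosDef) {t : ℝ}
    (ht : ∀ i, 2 * t * hS.1.eigenvalues i < 1) :
    Integrable (fun x => Real.exp (t * ‖x‖ ^ 2)) (multivariateGaussian 0 S) := by
  by_contra h
  -- A non-integrable function has Bochner integral zero, but the value of the integral is positive.
  have h0 := integral_undef h
  rw [integral_exp_mul_norm_sq_multivariateGaussian hS ht] at h0
  refine (Finset.prod_pos fun i _ => ?_).ne' h0
  have := ht i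
  exact inv_pos.2 (Real.sqrt_pos.2 (by linarith))

/-! ### Tail and small ball bounds for the norm of a Gaussian vector -/

/-- Chernoff's bound at the parameter `t = 1 / (4 ‖S‖)`, for which every factor of the moment
generating function satisfies `(1 - 2 t λ) ^ (-1/2) ≤ exp (2 t λ)`. -/
theorem multivariateGaussian_real_norm_sq_ge_le [Nonempty ι] (hS : S.PosDef) {δ : ℝ} (hδ : 0 < δ) :
    (multivariateGaussian 0 S).real {x | 2 * S.trace +
      4 * (‖toEuclideanCLM (𝕜 := ℝ) S‖ * Real.log (1 / δ)) ≤ ‖x‖ ^ 2} ≤ δ := by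
  obtain ⟨i₀, hi₀⟩ := exists_norm_toEuclideanCLM_eq_eigenvalues hS.posSemidef
  set B := ‖toEuclideanCLM (𝕜 := ℝ) S‖
  have hB : 0 < B := hi₀ ▸ hS.eigenvalues_pos i₀
  have hle (i : ι) : 2 * (1 / (4 * B)) * hS.1.eigenvalues i ≤ 1 / 2 := by
    have := eigenvalues_le_norm_toEuclideanCLM hS.1 i
    calc 2 * (1 / (4 * B)) * hS.1.eigenvalues i ≤ 2 * (1 / (4 * B)) * B := by gcongr
      _ = 1 / 2 := by field_simp; norm_num
  have ht (i : ι) : 2 * (1 / (4 * B)) * hS.1.eigenvalues i < 1 := (hle i).trans_lt (by norm_num)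
  have hch := measure_ge_le_exp_mul_mgf (X := fun x => ‖x‖ ^ 2)
    (μ := multivariateGaussian 0 S) (t := 1 / (4 * B))
    (2 * S.trace + 4 * (B * Real.log (1 / δ))) (by positivity)
    (integrable_exp_mul_norm_sq_multivariateGaussian hS ht)
  refine hch.trans ?_
  rw [mgf, integral_exp_mul_norm_sq_multivariateGaussian hS ht]
  have htr : S.trace = ∑ i, hS.1.eigenvalues i := by simpa using hS.1.trace_eq_sum_eigenvalues
  have hfac (x : ℝ) (h0 : 0 ≤ x) (h1 : x ≤ 1 / 2) : (√(1 - x))⁻¹ ≤ Real.exp x := by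
    rw [inv_le_comm₀ (Real.sqrt_pos.2 (by linarith)) (Real.exp_pos x), ← Real.exp_neg]
    refine Real.le_sqrt_of_sq_le ?_
    rw [← Real.exp_nat_mul, Nat.cast_ofNat]
    have h3 : 0 < 1 + 2 * x + 2 * x ^ 2 := by positivity
    -- The claim is `exp (-2x) ≤ 1 - x`; on `[0, 1/2]` the second-order bound on `exp (2x)` suffices.
    have h4 : 1 + 2 * x + 2 * x ^ 2 ≤ Real.exp (2 * x) := by
      have := Real.quadratic_le_exp_of_nonneg (x := 2 * x) (by linarith)
      nlinarith
    rw [show (2 : ℝ) * -x = -(2 * x) by ring, Real.exp_neg, inv_le_comm₀ (Real.exp_pos _)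
      (by linarith)]
    refine le_trans ?_ h4
    rw [inv_le_iff_one_le_mul₀ (by linarith)]
    nlinarith [mul_nonneg h0 (mul_nonneg h0 h0), mul_nonneg h0 (sub_nonneg.2 h1)]
  have hprod : ∏ i, (√(1 - 2 * (1 / (4 * B)) * hS.1.eigenvalues i))⁻¹ ≤
      Real.exp (1 / (4 * B) * (2 * S.trace)) := by
    calc _ ≤ ∏ i, Real.exp (2 * (1 / (4 * B)) * hS.1.eigenvalues i) := by
          refine Finset.prod_le_prod (fun i _ => by positivity) fun i _ =>
            hfac _ (mul_nonneg (by positivity) (hS.eigenvalues_pos i).le) (hle i)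
      _ = _ := by
          rw [← Real.exp_sum, ← Finset.mul_sum, htr]
          ring_nf
  calc _ ≤ Real.exp (-(1 / (4 * B)) * (2 * S.trace + 4 * (B * Real.log (1 / δ)))) *
        Real.exp (1 / (4 * B) * (2 * S.trace)) := by gcongr
    _ = Real.exp (Real.log δ) := by
        rw [← Real.exp_add, one_div δ, Real.log_inv]
        congr 1
        field_simp
        ring
    _ = δ := Real.exp_log hδ

theorem one_add_sum_le_prod_one_add {κ : Type*} (s : Finset κ) {f : κ → ℝ}
    (hf : ∀ i ∈ s, 0 ≤ f i) :
    1 + ∑ i ∈ s, f i ≤ ∏ i ∈ s, (1 + f i) := by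
  induction s using Finset.cons_induction with
  | empty => simp
  | cons a s ha ih =>
    have hs : ∀ i ∈ s, 0 ≤ f i := fun i hi => hf i (Finset.mem_cons_of_mem hi)
    have ha0 : 0 ≤ f a := hf a (Finset.mem_cons_self a s)
    rw [Finset.sum_cons, Finset.prod_cons]
    nlinarith [ih hs, mul_nonneg ha0 (Finset.sum_nonneg hs),
      mul_le_mul_of_nonneg_left (ih hs) ha0]

/-- Markov's inequality for `exp (-s ‖x‖ ^ 2)` with `s = 16 / tr S`, whose expectation is at most
`(1 + 2 s tr S) ^ (-1/2) = 33 ^ (-1/2)`. The factor `exp (s r)` at the radius `r = tr S / 16` is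
`e`, and `e / √33 < 1 / 2`. -/
theorem multivariateGaussian_real_norm_sq_le_lt_half [Nonempty ι] (hS : S.PosDef) :
    (multivariateGaussian 0 S).real {x | ‖x‖ ^ 2 ≤ S.trace / 16} < 1 / 2 := by
  have htr : S.trace = ∑ i, hS.1.eigenvalues i := by simpa using hS.1.trace_eq_sum_eigenvalues
  have hpos : 0 < S.trace := by
    rw [htr]
    exact Finset.sum_pos (fun i _ => hS.eigenvalues_pos i) Finset.univ_nonempty
  have hs : 0 < 16 / S.trace := by positivity
  have ht (i : ι) : 2 * (-(16 / S.trace)) * hS.1.eigenvalues i < 1 := by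
    nlinarith [mul_pos hs (hS.eigenvalues_pos i)]
  have hch := measure_le_le_exp_mul_mgf (X := fun x => ‖x‖ ^ 2)
    (μ := multivariateGaussian 0 S) (t := -(16 / S.trace)) (S.trace / 16) (by linarith)
    (integrable_exp_mul_norm_sq_multivariateGaussian hS ht)
  refine hch.trans_lt ?_
  rw [mgf, integral_exp_mul_norm_sq_multivariateGaussian hS ht]
  have hprod : (33 : ℝ) ≤ ∏ i, (1 - 2 * (-(16 / S.trace)) * hS.1.eigenvalues i) := by
    have h1 : 1 + ∑ i, 2 * (16 / S.trace) * hS.1.eigenvalues i ≤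
        ∏ i, (1 + 2 * (16 / S.trace) * hS.1.eigenvalues i) :=
      one_add_sum_le_prod_one_add _ fun i _ => mul_nonneg (by positivity) (hS.eigenvalues_pos i).le
    rw [← Finset.mul_sum, ← htr] at h1
    calc (33 : ℝ) = 1 + 2 * (16 / S.trace) * S.trace := by field_simp; norm_num
      _ ≤ _ := h1
      _ = _ := Finset.prod_congr rfl fun i _ => by ring
  have hexp : Real.exp (-(-(16 / S.trace)) * (S.trace / 16)) = Real.exp 1 := by
    congr 1
    field_simp
  rw [hexp, Finset.prod_inv_distrib, ← Real.sqrt_prod _ fun i _ => by have := ht i; linarith,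
    ← div_eq_mul_inv, div_lt_div_iff₀ (Real.sqrt_pos.2 (by linarith)) two_pos, one_mul]
  refine Real.lt_sqrt_of_sq_lt (lt_of_lt_of_le ?_ hprod)
  have := Real.exp_one_lt_d9
  nlinarith [Real.exp_pos 1]

/-- The norm dominates the coordinate along an eigenvector of the largest eigenvalue, a Gaussian
variable of variance `‖S‖`. -/
theorem exp_neg_div_eight_le_multivariateGaussian_real [Nonempty ι] (hS : S.PosDef) {r : ℝ}
    (hr : 0 ≤ r) :
    Real.exp (-r / ‖toEuclideanCLM (𝕜 := ℝ) S‖) / 8 ≤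
      (multivariateGaussian 0 S).real {x | r < ‖x‖ ^ 2} := by
  obtain ⟨i, hi⟩ := exists_norm_toEuclideanCLM_eq_eigenvalues hS.posSemidef
  have hpos := hS.eigenvalues_pos i
  have hc : ((hS.1.eigenvalues i).toNNReal : ℝ) = hS.1.eigenvalues i :=
    Real.coe_toNNReal _ hpos.le
  have hlaw : (multivariateGaussian 0 S).map (fun x => ⟪hS.1.eigenvectorBasis i, x⟫) =
      gaussianReal 0 (hS.1.eigenvalues i).toNNReal := by
    rw [← (measurePreserving_eval (fun i => gaussianReal 0 (hS.1.eigenvalues i).toNNReal) i).map_eq,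
      ← map_eigenvectorBasis_multivariateGaussian hS.posSemidef,
      Measure.map_map (by fun_prop) (by fun_prop)]
    rfl
  have htail := exp_neg_sq_div_eight_le_gaussianReal_Ioi
    (v := (hS.1.eigenvalues i).toNNReal) (by simpa using hpos) (Real.sqrt_nonneg r)
  rw [Real.sq_sqrt hr, hc, ← hlaw, map_measureReal_apply (by fun_prop) measurableSet_Ioi] at htail
  rw [hi]
  refine htail.trans (measureReal_mono fun x hx => ?_)
  have hx' : √r < ⟪hS.1.eigenvectorBasis i, x⟫ := hx
  have hn : ⟪hS.1.eigenvectorBasis i, x⟫ ≤ ‖x‖ := by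
    simpa [hS.1.eigenvectorBasis.norm_eq_one i] using
      real_inner_le_norm (hS.1.eigenvectorBasis i) x
  exact (Real.sqrt_lt_sqrt_iff hr).1 (by
    rw [Real.sqrt_sq (norm_nonneg x)]; exact hx'.trans_le hn)

end Spectral

/-! ### Exchanging the mean and the average noise -/

section Swap

variable {E : Type*} [NormedAddCommGroup E] [NormedSpace ℝ E]

variable (E) in
/-- The sample mean of `n` vectors as a continuous linear map. -/
noncomputable def meanCLM (n : ℕ) : (Fin n → E) →L[ℝ] E :=
  (n : ℝ)⁻¹ • ∑ i, ContinuousLinearMap.proj i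

theorem meanCLM_apply {n : ℕ} (x : Fin n → E) : meanCLM E n x = (n : ℝ)⁻¹ • ∑ i, x i := by
  simp [meanCLM]

variable (E) in
/-- The map `(θ, ε) ↦ (ε̄, ε - ε̄ + θ)`, where `ε̄` is the mean of the noise vectors `ε i`. It
exchanges `θ` with `ε̄` and keeps every observation `θ + ε i` fixed. -/
noncomputable def swapCLM (n : ℕ) : (E × (Fin n → E)) →L[ℝ] (E × (Fin n → E)) :=
  ((meanCLM E n).comp (.snd ℝ E _)).prod (ContinuousLinearMap.pi fun i =>
    (ContinuousLinearMap.proj i).comp (.snd ℝ E _) - (meanCLM E n).comp (.snd ℝ E _) + .fst ℝ E _)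

theorem swapCLM_fst {n : ℕ} (p : E × (Fin n → E)) : (swapCLM E n p).1 = meanCLM E n p.2 := rfl

theorem swapCLM_snd {n : ℕ} (p : E × (Fin n → E)) (i : Fin n) :
    (swapCLM E n p).2 i = p.2 i - meanCLM E n p.2 + p.1 := by
  simp [swapCLM]

variable [MeasurableSpace E] [BorelSpace E] [SecondCountableTopology E] [CompleteSpace E]

theorem charFunDual_map_meanCLM {n : ℕ} (hn : n ≠ 0) (μ : Measure E) [IsGaussian μ]
    (hμ : ∫ x, x ∂μ = 0) (L : StrongDual ℝ E) :
    charFunDual ((Measure.pi fun _ : Fin n => μ).map (meanCLM E n)) L =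
      Complex.exp (-((n : ℝ)⁻¹ * covarianceBilinDual μ L L : ℝ) / 2) := by
  have h (i : Fin n) : (L.comp (meanCLM E n)).comp (.single ℝ (fun _ => E) i) = (n : ℝ)⁻¹ • L := by
    ext x
    simp [meanCLM_apply]
  have hn' : (n : ℂ) ≠ 0 := by exact_mod_cast hn
  rw [charFunDual_map, charFunDual_pi]
  simp_rw [h, IsGaussian.charFunDual_eq', id, hμ]
  simp only [map_zero, Complex.ofReal_zero, zero_mul, zero_sub, map_smul,
    _root_.smul_apply, smul_eq_mul, Finset.prod_const, Finset.card_univ,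
    Fintype.card_fin, ← Complex.exp_nat_mul]
  congr 1
  push_cast
  field_simp

/-- If the prior on `θ` is the law of the mean noise `ε̄`, then exchanging `θ` and `ε̄` preserves
the joint law of `θ` and the noise. Under the exchange, the functional `a θ + ∑ b i (ε i)` becomes
the one with coefficients `∑ b j` and `b i + (a - ∑ b j) / n`, and the variance
`⟨a, a⟩ / n + ∑ ⟨b i, b i⟩` stays the same. -/
theorem measurePreserving_swapCLM {n : ℕ} (hn : n ≠ 0) (μ : Measure E) [IsGaussian μ]
    (hμ : ∫ x, x ∂μ = 0) :
    MeasurePreserving (swapCLM E n)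
      (((Measure.pi fun _ : Fin n => μ).map (meanCLM E n)).prod (Measure.pi fun _ => μ))
      (((Measure.pi fun _ : Fin n => μ).map (meanCLM E n)).prod (Measure.pi fun _ => μ)) := by
  have := Measure.isProbabilityMeasure_map (μ := Measure.pi fun _ : Fin n => μ)
    (meanCLM E n).measurable.aemeasurable
  refine ⟨(swapCLM E n).measurable, ?_⟩
  have := Measure.isProbabilityMeasure_map
    (μ := ((Measure.pi fun _ : Fin n => μ).map (meanCLM E n)).prod (Measure.pi fun _ => μ))
    (swapCLM E n).measurable.aemeasurable
  refine Measure.ext_of_charFunDual (funext fun L => ?_)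
  rw [charFunDual_map, charFunDual_prod, charFunDual_prod, charFunDual_pi, charFunDual_pi,
    charFunDual_map_meanCLM hn μ hμ, charFunDual_map_meanCLM hn μ hμ]
  set a := L.comp (.inl ℝ E (Fin n → E)) with ha
  set b : Fin n → StrongDual ℝ E := fun i =>
    (L.comp (.inr ℝ E (Fin n → E))).comp (.single ℝ (fun _ => E) i) with hb
  have hL (p : E × (Fin n → E)) : L p = a p.1 + ∑ i, b i (p.2 i) := by
    conv_lhs => rw [← L.comp_inl_add_comp_inr p,
      ← (L.comp (.inr ℝ E (Fin n → E))).sum_comp_single]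
  have h1 : (L.comp (swapCLM E n)).comp (.inl ℝ E (Fin n → E)) = ∑ i, b i := by
    ext x
    simp [hL, swapCLM_fst, swapCLM_snd]
  have h2 (i : Fin n) : ((L.comp (swapCLM E n)).comp (.inr ℝ E (Fin n → E))).comp
      (.single ℝ (fun _ => E) i) = b i + (n : ℝ)⁻¹ • (a - ∑ j, b j) := by
    ext x
    have h3 : ∑ j, b j ((Pi.single i x : Fin n → E) j) = b i x := by
      rw [Finset.sum_eq_single i] <;> simp +contextual
    simp [hL, swapCLM_fst, swapCLM_snd, meanCLM_apply, h3, ← Finset.mul_sum]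
    ring
  change _ = _ * ∏ i, charFunDual μ (b i)
  rw [h1]
  simp_rw [h2, IsGaussian.charFunDual_eq', id, hμ]
  simp only [map_zero, Complex.ofReal_zero, zero_mul, zero_sub, ← Complex.exp_sum,
    ← Complex.exp_add]
  congr 1
  set s := ∑ i, b i with hs
  have hB : (n : ℝ)⁻¹ * covarianceBilinDual μ s s + ∑ i, covarianceBilinDual μ
      (b i + (n : ℝ)⁻¹ • (a - s)) (b i + (n : ℝ)⁻¹ • (a - s)) =
      (n : ℝ)⁻¹ * covarianceBilinDual μ a a + ∑ i, covarianceBilinDual μ (b i) (b i) := by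
    have hn' : (n : ℝ) ≠ 0 := by exact_mod_cast hn
    have hl (c) : ∑ i, covarianceBilinDual μ (b i) c = covarianceBilinDual μ s c := by
      rw [hs, map_sum, _root_.sum_apply]
    simp only [map_add, map_smul, _root_.add_apply, _root_.smul_apply,
      smul_eq_mul, Finset.sum_add_distrib, ← Finset.mul_sum, hl, Finset.sum_const,
      Finset.card_univ, Fintype.card_fin, nsmul_eq_mul, covarianceBilinDual_comm (a - s) (b _)]
    rw [show covarianceBilinDual μ a a = covarianceBilinDual μ (s + (a - s)) (s + (a - s)) by
      rw [add_sub_cancel]]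
    simp only [map_add, _root_.add_apply]
    rw [covarianceBilinDual_comm (a - s) s]
    field_simp
    ring
  have hB' := congrArg (fun x : ℝ => -(x : ℂ) / 2) hB
  simp only [Complex.ofReal_add, Complex.ofReal_sum] at hB'
  simp only [Finset.sum_neg_distrib, ← Finset.sum_div]
  linear_combination hB'

end Swap

/-! ### Laws in the Gaussian location model -/

section Model

variable {d : ℕ} {S : Matrix (Fin d) (Fin d) ℝ}

theorem map_meanCLM_pi_multivariateGaussian {n : ℕ} (hn : n ≠ 0) (hS : S.PosSemidef) :
    (Measure.pi fun _ : Fin n => multivariateGaussian 0 S).map (meanCLM _ n) =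
      multivariateGaussian 0 ((n : ℝ)⁻¹ • S) := by
  have := Measure.isProbabilityMeasure_map
    (μ := Measure.pi fun _ : Fin n => multivariateGaussian (0 : EuclideanSpace ℝ (Fin d)) S)
    (meanCLM (EuclideanSpace ℝ (Fin d)) n).measurable.aemeasurable
  refine Measure.ext_of_charFun (funext fun t => ?_)
  have hn' : (n : ℂ) ≠ 0 := by exact_mod_cast hn
  simp_rw [funext (meanCLM_apply (E := EuclideanSpace ℝ (Fin d)) (n := n))]
  rw [charFun_map_smul_comp (by fun_prop), charFun_map_sum_pi_eq_prod,
    charFun_multivariateGaussian (hS.smul (by positivity))]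
  simp only [Finset.prod_apply, charFun_multivariateGaussian hS, Finset.prod_const,
    Finset.card_univ, Fintype.card_fin, ← Complex.exp_nat_mul]
  congr 1
  simp [mulVec_smul, smul_mulVec]
  field_simp

theorem map_sub_prod_multivariateGaussian (hS : S.PosSemidef) :
    ((multivariateGaussian (0 : EuclideanSpace ℝ (Fin d)) S).prod
      (multivariateGaussian 0 S)).map (fun p => p.1 - p.2) =
      multivariateGaussian 0 ((2 : ℝ) • S) := by
  have := Measure.isProbabilityMeasure_map
    (μ := (multivariateGaussian (0 : EuclideanSpace ℝ (Fin d)) S).prod (multivariateGaussian 0 S))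
    (f := fun p => p.1 - p.2) (by fun_prop)
  refine Measure.ext_of_charFun (funext fun t => ?_)
  rw [charFun_apply, integral_map (by fun_prop) (by fun_prop)]
  have h (p : EuclideanSpace ℝ (Fin d) × EuclideanSpace ℝ (Fin d)) :
      Complex.exp ((inner ℝ (p.1 - p.2) t : ℝ) * Complex.I) =
      Complex.exp ((inner ℝ p.1 t : ℝ) * Complex.I) *
        Complex.exp ((inner ℝ p.2 (-t) : ℝ) * Complex.I) := by
    rw [← Complex.exp_add, inner_sub_left, inner_neg_right]
    push_cast
    ring_nf
  simp_rw [h]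
  rw [integral_prod_mul (fun x => Complex.exp ((inner ℝ x t : ℝ) * Complex.I))
    (fun x => Complex.exp ((inner ℝ x (-t) : ℝ) * Complex.I)), ← charFun_apply, ← charFun_apply,
    charFun_multivariateGaussian hS, charFun_multivariateGaussian hS,
    charFun_multivariateGaussian (hS.smul two_pos.le), ← Complex.exp_add]
  congr 1
  simp [mulVec_neg, smul_mulVec]
  ring

theorem multivariateGaussian_eq_map_add (θ : EuclideanSpace ℝ (Fin d)) :
    multivariateGaussian θ S = (multivariateGaussian 0 S).map (θ + ·) := by
  rw [multivariateGaussian, multivariateGaussian, Measure.map_map (by fun_prop) (by fun_prop)]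
  congr 1
  ext1 x
  simp

theorem pi_multivariateGaussian_eq_map_add (n : ℕ) (θ : EuclideanSpace ℝ (Fin d)) :
    Measure.pi (fun _ : Fin n => multivariateGaussian θ S) =
      (Measure.pi fun _ : Fin n => multivariateGaussian 0 S).map (fun ε i => θ + ε i) := by
  have (i : Fin n) : SigmaFinite ((multivariateGaussian 0 S).map (θ + ·)) := by
    rw [← multivariateGaussian_eq_map_add]; infer_instance
  rw [Measure.pi_map_pi (f := fun _ x => θ + x) fun i => by fun_prop,
    ← multivariateGaussian_eq_map_add]

end Model

variable {d : ℕ} {S : Matrix (Fin d) (Fin d) ℝ}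

/-! ### The lower bound -/

/-- If an estimator has loss at most `R` with probability at least `1 - δ` at every `θ`, then the
difference of two independent copies of the mean noise has squared norm at most `4 R` with
probability at least `1 - 2 δ`. Put the law of the mean noise `ε̄` as a prior on `θ`. Exchanging
`θ` and `ε̄` preserves the joint law and the observations, so the same value of the estimator is
close to both `θ` and `ε̄`. -/
theorem multivariateGaussian_real_le_of_forall_loss_le {n : ℕ} (hn : n ≠ 0) (hS : S.PosSemidef)
    {T : (Fin n → EuclideanSpace ℝ (Fin d)) → EuclideanSpace ℝ (Fin d)} (hT : Measurable T)
    {δ R : ℝ} (hδ : 0 ≤ δ)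
    (h : ∀ θ, ENNReal.ofReal (1 - δ) ≤
      Measure.pi (fun _ : Fin n => multivariateGaussian θ S) {x | sqLoss (T x) θ ≤ R}) :
    (multivariateGaussian 0 ((2 : ℝ) • (n : ℝ)⁻¹ • S)).real {x | 4 * R < ‖x‖ ^ 2} ≤ 2 * δ := by
  set P := Measure.pi fun _ : Fin n => multivariateGaussian (0 : EuclideanSpace ℝ (Fin d)) S with hP
  set ν := multivariateGaussian (0 : EuclideanSpace ℝ (Fin d)) ((n : ℝ)⁻¹ • S) with hν
  have hmean : P.map (meanCLM _ n) = ν := map_meanCLM_pi_multivariateGaussian hn hS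
  have hswap := measurePreserving_swapCLM hn (multivariateGaussian (0 : EuclideanSpace ℝ (Fin d)) S)
    integral_id_multivariateGaussian
  rw [← hP, hmean] at hswap
  set A : Set (EuclideanSpace ℝ (Fin d) × (Fin n → EuclideanSpace ℝ (Fin d))) :=
    {p | R < ‖T (fun i => p.1 + p.2 i) - p.1‖ ^ 2} with hA
  have hAm : MeasurableSet A :=
    measurableSet_lt measurable_const (by fun_prop)
  have hPA : (ν.prod P) A ≤ ENNReal.ofReal δ := by
    rw [Measure.prod_apply hAm]
    calc _ ≤ ∫⁻ _, ENNReal.ofReal δ ∂ν := lintegral_mono fun θ => ?_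
      _ = ENNReal.ofReal δ := by simp
    have hms : MeasurableSet {x : Fin n → EuclideanSpace ℝ (Fin d) | sqLoss (T x) θ ≤ R} := by
      unfold sqLoss
      exact measurableSet_le (by fun_prop) measurable_const
    have hθ : P (Prod.mk θ ⁻¹' A) = Measure.pi (fun _ : Fin n => multivariateGaussian θ S)
        {x | sqLoss (T x) θ ≤ R}ᶜ := by
      rw [pi_multivariateGaussian_eq_map_add, Measure.map_apply (by fun_prop) hms.compl]
      congr 1
      ext ε
      simp [hA, sqLoss]
    rw [hθ, prob_compl_eq_one_sub hms, tsub_le_iff_right]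
    calc (1 : ℝ≥0∞) = ENNReal.ofReal (δ + (1 - δ)) := by simp
      _ ≤ ENNReal.ofReal δ + ENNReal.ofReal (1 - δ) := ENNReal.ofReal_add_le
      _ ≤ _ := by gcongr; exact h θ
  have hPA' : (ν.prod P) (swapCLM _ n ⁻¹' A) ≤ ENNReal.ofReal δ := by
    rwa [hswap.measure_preimage hAm.nullMeasurableSet]
  have hlaw : (ν.prod P).map (fun p => p.1 - meanCLM _ n p.2) =
      multivariateGaussian 0 ((2 : ℝ) • (n : ℝ)⁻¹ • S) := by
    rw [← map_sub_prod_multivariateGaussian (hS.smul (by positivity)), ← hν]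
    have hprod : ν.prod ν = (ν.prod P).map (Prod.map id (meanCLM _ n)) := by
      rw [← Measure.map_prod_map _ _ measurable_id (by fun_prop), Measure.map_id, hmean]
    rw [hprod, Measure.map_map (by fun_prop) (by fun_prop)]
    rfl
  -- The two errors of the common estimate add up, by the triangle inequality.
  have hsub : {p : EuclideanSpace ℝ (Fin d) × (Fin n → EuclideanSpace ℝ (Fin d)) |
      4 * R < ‖p.1 - meanCLM _ n p.2‖ ^ 2} ⊆ A ∪ swapCLM _ n ⁻¹' A := by
    intro p hp
    by_contra hcon
    have hobs : (fun i => (swapCLM _ n p).1 + (swapCLM _ n p).2 i) = fun i => p.1 + p.2 i := by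
      ext1 i
      rw [swapCLM_fst, swapCLM_snd]
      abel
    simp only [hA, Set.mem_union, Set.mem_preimage, Set.mem_ofPred_eq, not_or, not_lt, hobs] at hcon
    obtain ⟨h1, h2⟩ := hcon
    rw [swapCLM_fst] at h2
    set y := T fun i => p.1 + p.2 i
    have hp' : 4 * R < ‖p.1 - meanCLM _ n p.2‖ ^ 2 := hp
    have htri : ‖p.1 - meanCLM _ n p.2‖ ≤ ‖y - meanCLM _ n p.2‖ + ‖y - p.1‖ := by
      rw [← sub_sub_sub_cancel_left (meanCLM _ n p.2) p.1 y]
      exact norm_sub_le _ _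
    nlinarith [norm_nonneg (p.1 - meanCLM _ n p.2),
      sq_nonneg (‖y - meanCLM _ n p.2‖ - ‖y - p.1‖), norm_nonneg (y - p.1),
      norm_nonneg (y - meanCLM _ n p.2)]
  rw [← hlaw, map_measureReal_apply (by fun_prop)
    (measurableSet_lt measurable_const (by fun_prop)), measureReal_def]
  refine ENNReal.toReal_le_of_le_ofReal (by linarith) ?_
  calc _ ≤ (ν.prod P) (A ∪ swapCLM _ n ⁻¹' A) := measure_mono hsub
    _ ≤ (ν.prod P) A + (ν.prod P) (swapCLM _ n ⁻¹' A) := measure_union_le _ _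
    _ ≤ ENNReal.ofReal δ + ENNReal.ofReal δ := add_le_add hPA hPA'
    _ = ENNReal.ofReal (2 * δ) := by rw [← ENNReal.ofReal_add hδ hδ, two_mul]

theorem norm_toEuclideanCLM_smul {a : ℝ} (ha : 0 ≤ a) :
    ‖toEuclideanCLM (𝕜 := ℝ) (a • S)‖ = a * ‖toEuclideanCLM (𝕜 := ℝ) S‖ := by
  rw [map_smul, norm_smul, Real.norm_of_nonneg ha]

theorem norm_toEuclideanCLM_le_trace [Nonempty (Fin d)] (hS : S.PosSemidef) :
    ‖toEuclideanCLM (𝕜 := ℝ) S‖ ≤ S.trace := by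
  obtain ⟨i, hi⟩ := exists_norm_toEuclideanCLM_eq_eigenvalues hS
  have htr : S.trace = ∑ i, hS.1.eigenvalues i := by simpa using hS.1.trace_eq_sum_eigenvalues
  rw [hi, htr]
  exact Finset.single_le_sum (fun j _ => hS.eigenvalues_nonneg j) (Finset.mem_univ i)

theorem gaussianRate_pos [Nonempty (Fin d)] {n : ℕ} (hn : n ≠ 0) (hS : S.PosDef) {δ : ℝ}
    (hδ : 0 < δ) (hδ1 : δ ≤ 1) : 0 < gaussianRate n S δ := by
  have hn' : (0 : ℝ) < n := by exact_mod_cast Nat.pos_of_ne_zero hn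
  have hlog : 0 ≤ Real.log (1 / δ) := Real.log_nonneg (by rwa [le_div_iff₀ hδ, one_mul])
  have := hS.trace_pos
  unfold gaussianRate
  positivity

/-- The trace term comes from the small ball bound and the logarithmic term from the lower tail
bound, except that for `δ` bounded away from zero the logarithmic term is absorbed by the trace. -/
theorem gaussianRate_le_of_forall_loss_le [Nonempty (Fin d)] {n : ℕ} (hn : n ≠ 0) (hS : S.PosDef)
    {T : (Fin n → EuclideanSpace ℝ (Fin d)) → EuclideanSpace ℝ (Fin d)} (hT : Measurable T)
    {δ R : ℝ} (hδ : 0 < δ) (hδ4 : δ ≤ 1 / 4) (hR : 0 ≤ R)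
    (h : ∀ θ, ENNReal.ofReal (1 - δ) ≤
      Measure.pi (fun _ : Fin n => multivariateGaussian θ S) {x | sqLoss (T x) θ ≤ R}) :
    gaussianRate n S δ ≤ 256 * R := by
  have hn' : (0 : ℝ) < n := by exact_mod_cast Nat.pos_of_ne_zero hn
  have hprob := multivariateGaussian_real_le_of_forall_loss_le hn hS.posSemidef hT hδ.le h
  have hS' : ((2 : ℝ) • (n : ℝ)⁻¹ • S).PosDef := (hS.smul (inv_pos.2 hn')).smul two_pos
  set B := ‖toEuclideanCLM (𝕜 := ℝ) S‖ with hB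
  have hBpos : 0 < B := by
    obtain ⟨i, hi⟩ := exists_norm_toEuclideanCLM_eq_eigenvalues hS.posSemidef
    rw [hB, hi]
    exact hS.eigenvalues_pos i
  have hBtr : B ≤ S.trace := norm_toEuclideanCLM_le_trace hS.posSemidef
  have htrace : S.trace / n ≤ 32 * R := by
    by_contra! hlt
    have hsmall := multivariateGaussian_real_norm_sq_le_lt_half hS'
    have hle : 4 * R ≤ ((2 : ℝ) • (n : ℝ)⁻¹ • S).trace / 16 := by
      rw [trace_smul, trace_smul, smul_eq_mul, smul_eq_mul, ← div_eq_inv_mul]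
      linarith
    have hmono : (multivariateGaussian 0 ((2 : ℝ) • (n : ℝ)⁻¹ • S)).real {x | ‖x‖ ^ 2 ≤ 4 * R} ≤
        (multivariateGaussian 0 ((2 : ℝ) • (n : ℝ)⁻¹ • S)).real
          {x | ‖x‖ ^ 2 ≤ ((2 : ℝ) • (n : ℝ)⁻¹ • S).trace / 16} :=
      measureReal_mono fun x (hx : ‖x‖ ^ 2 ≤ 4 * R) => hx.trans hle
    have hcompl := probReal_compl_eq_one_sub
      (μ := multivariateGaussian 0 ((2 : ℝ) • (n : ℝ)⁻¹ • S))
      (s := {x | 4 * R < ‖x‖ ^ 2}) (measurableSet_lt measurable_const (by fun_prop))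
    have hset : {x : EuclideanSpace ℝ (Fin d) | 4 * R < ‖x‖ ^ 2}ᶜ = {x | ‖x‖ ^ 2 ≤ 4 * R} := by
      ext x; simp
    rw [hset] at hcompl
    linarith
  have hlog : B * Real.log (1 / δ) / n ≤ 192 * R := by
    rcases le_or_gt δ (1 / 256) with hsmall | hlarge
    · have htail := (exp_neg_div_eight_le_multivariateGaussian_real hS'
        (by linarith : 0 ≤ 4 * R)).trans hprob
      rw [norm_toEuclideanCLM_smul two_pos.le, norm_toEuclideanCLM_smul (by positivity), ← hB]
        at htail
      have hexp : Real.exp (-(4 * R) / (2 * ((n : ℝ)⁻¹ * B))) ≤ 16 * δ := by linarith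
      rw [← Real.le_log_iff_exp_le (by positivity)] at hexp
      -- For `δ ≤ 1 / 256` one has `16 δ ≤ √δ`.
      have hsq : Real.log (16 * δ) ≤ Real.log δ / 2 := by
        rw [← Real.log_sqrt hδ.le]
        refine Real.log_le_log (by positivity) (Real.le_sqrt_of_sq_le ?_)
        nlinarith
      rw [one_div, Real.log_inv, div_le_iff₀ hn']
      have heq : -(4 * R) / (2 * ((n : ℝ)⁻¹ * B)) = -(2 * R * n / B) := by
        field_simp
        ring
      rw [heq] at hexp
      have h3 : -Real.log δ ≤ 4 * R * n / B := by
        have : 4 * R * n / B = 2 * (2 * R * n / B) := by ring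
        linarith
      rw [le_div_iff₀ hBpos] at h3
      nlinarith [mul_nonneg hR hn'.le]
    · have h6 : Real.log (1 / δ) ≤ 6 := by
        rw [Real.log_le_iff_le_exp (by positivity), one_div_le hδ (Real.exp_pos 6)]
        refine le_trans ?_ hlarge.le
        refine one_div_le_one_div_of_le (by norm_num) ?_
        have h1 := Real.exp_one_gt_d9
        have h2 : Real.exp 6 = Real.exp 1 ^ 6 := by rw [← Real.exp_nat_mul]; norm_num
        rw [h2]
        calc (256 : ℝ) ≤ 2.7 ^ 6 := by norm_num
          _ ≤ Real.exp 1 ^ 6 := by gcongr; linarith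
      calc B * Real.log (1 / δ) / n ≤ S.trace * 6 / n := by
            have h0 : 0 ≤ Real.log (1 / δ) :=
              Real.log_nonneg (by rw [le_div_iff₀ hδ]; linarith)
            have := hS.trace_pos
            gcongr
        _ = 6 * (S.trace / n) := by ring
        _ ≤ 192 * R := by linarith
  unfold gaussianRate
  rw [← hB]
  linarith

theorem ofReal_le_measure_of_quantile_lt {X : Type*} [MeasurableSpace X] {δ R : ℝ} {P : Measure X}
    {ℓ : X → ℝ} (h : quantile δ P ℓ < ENNReal.ofReal R) :
    ENNReal.ofReal (1 - δ) ≤ P {x | ℓ x ≤ R} := by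
  simp only [quantile, iInf_lt_iff] at h
  obtain ⟨r, hr, hrR⟩ := h
  have hle : (r : ℝ) ≤ R := by
    have := (ENNReal.lt_ofReal_iff_toReal_lt ENNReal.coe_ne_top).1 hrR
    simpa using this.le
  exact hr.trans (measure_mono fun x (hx : ℓ x ≤ r) => hx.trans hle)

theorem ofReal_gaussianRate_le_minimaxQuantile [Nonempty (Fin d)] {n : ℕ} (hn : n ≠ 0)
    (hS : S.PosDef) {δ : ℝ} (hδ : 0 < δ) (hδ4 : δ ≤ 1 / 4) :
    ENNReal.ofReal (1 / 512 * gaussianRate n S δ) ≤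
      minimaxQuantile δ (gaussianModel n S) sqLoss := by
  refine le_iInf₂ fun T hT => ?_
  by_contra! hlt
  have hpos := gaussianRate_pos hn hS hδ (by linarith)
  have := gaussianRate_le_of_forall_loss_le hn hS hT hδ hδ4 (R := 1 / 512 * gaussianRate n S δ)
    (by positivity) fun θ => ofReal_le_measure_of_quantile_lt <| lt_of_le_of_lt
      (le_iSup_of_le (f := fun θ => ⨆ P ∈ gaussianModel n S θ,
        quantile δ P fun x => sqLoss (T x) θ) θ <|
        le_iSup₂_of_le (f := fun P _ => quantile δ P _)
          (Measure.pi fun _ : Fin n => multivariateGaussian θ S) rfl le_rfl) hlt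
  linarith

/-! ### The upper bound -/

theorem sampleMean_eq_meanCLM {n : ℕ} (x : Fin n → EuclideanSpace ℝ (Fin d)) :
    sampleMean n x = meanCLM _ n x := by
  rw [sampleMean, meanCLM_apply]

theorem worstQuantile_sampleMean_le [Nonempty (Fin d)] {n : ℕ} (hn : n ≠ 0)
    (hS : S.PosDef) {δ : ℝ} (hδ : 0 < δ) (hδ1 : δ ≤ 1) :
    worstQuantile δ (gaussianModel n S) sqLoss (sampleMean n) ≤
      ENNReal.ofReal (4 * gaussianRate n S δ) := by
  have hn' : (0 : ℝ) < n := by exact_mod_cast Nat.pos_of_ne_zero hn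
  have hrate := gaussianRate_pos hn hS hδ hδ1
  refine iSup_le fun θ => iSup₂_le fun P hP => ?_
  obtain rfl : P = Measure.pi fun _ : Fin n => multivariateGaussian θ S := hP
  refine iInf₂_le (4 * gaussianRate n S δ).toNNReal ?_
  rw [Real.coe_toNNReal _ (by positivity)]
  have hms : MeasurableSet {x : Fin n → EuclideanSpace ℝ (Fin d) |
      sqLoss (sampleMean n x) θ ≤ 4 * gaussianRate n S δ} := by
    simp_rw [sqLoss, sampleMean_eq_meanCLM]
    exact measurableSet_le (by fun_prop) measurable_const
  have hmsx : MeasurableSet {x : EuclideanSpace ℝ (Fin d) | ‖x‖ ^ 2 ≤ 4 * gaussianRate n S δ} :=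
    measurableSet_le (by fun_prop) measurable_const
  -- The error of the sample mean is the mean of the noise.
  have hlaw : Measure.pi (fun _ : Fin n => multivariateGaussian θ S)
      {x | sqLoss (sampleMean n x) θ ≤ 4 * gaussianRate n S δ} =
      multivariateGaussian 0 ((n : ℝ)⁻¹ • S) {x | ‖x‖ ^ 2 ≤ 4 * gaussianRate n S δ} := by
    rw [pi_multivariateGaussian_eq_map_add, Measure.map_apply (by fun_prop) hms,
      ← map_meanCLM_pi_multivariateGaussian hn hS.posSemidef,
      Measure.map_apply (by fun_prop) hmsx]
    congr 1
    ext ε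
    have : (n : ℝ)⁻¹ • ∑ i, (θ + ε i) - θ = (n : ℝ)⁻¹ • ∑ i, ε i := by
      rw [Finset.sum_add_distrib, Finset.sum_const, Finset.card_univ, Fintype.card_fin, smul_add,
        ← Nat.cast_smul_eq_nsmul ℝ, smul_smul, inv_mul_cancel₀ hn'.ne', one_smul,
        add_sub_cancel_left]
    simp [sqLoss, sampleMean, meanCLM_apply, this]
  rw [hlaw, ENNReal.ofReal_le_iff_le_toReal (measure_ne_top _ _), ← measureReal_def]
  have hS' : ((n : ℝ)⁻¹ • S).PosDef := hS.smul (inv_pos.2 hn')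
  have htail := multivariateGaussian_real_norm_sq_ge_le hS' hδ
  have hle : 2 * ((n : ℝ)⁻¹ • S).trace +
      4 * (‖toEuclideanCLM (𝕜 := ℝ) ((n : ℝ)⁻¹ • S)‖ * Real.log (1 / δ)) ≤
      4 * gaussianRate n S δ := by
    have : 0 < S.trace / n := div_pos hS.trace_pos hn'
    rw [norm_toEuclideanCLM_smul (by positivity), trace_smul, smul_eq_mul, ← div_eq_inv_mul,
      gaussianRate, mul_add]
    have h2 : (n : ℝ)⁻¹ * ‖toEuclideanCLM (𝕜 := ℝ) S‖ * Real.log (1 / δ) =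
        ‖toEuclideanCLM (𝕜 := ℝ) S‖ * Real.log (1 / δ) / n := by ring
    rw [h2]
    linarith
  have hcompl := probReal_compl_eq_one_sub (μ := multivariateGaussian 0 ((n : ℝ)⁻¹ • S)) hmsx
  have hsub : {x : EuclideanSpace ℝ (Fin d) | ‖x‖ ^ 2 ≤ 4 * gaussianRate n S δ}ᶜ ⊆
      {x | 2 * ((n : ℝ)⁻¹ • S).trace +
        4 * (‖toEuclideanCLM (𝕜 := ℝ) ((n : ℝ)⁻¹ • S)‖ * Real.log (1 / δ)) ≤ ‖x‖ ^ 2} :=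
    fun x hx => hle.trans (not_le.1 (by simpa using hx : ¬ ‖x‖ ^ 2 ≤ 4 * gaussianRate n S δ)).le
  have hmono := measureReal_mono (μ := multivariateGaussian 0 ((n : ℝ)⁻¹ • S)) hsub
  linarith

end MinimaxQuantile

theorem mainTheorem6 :
    ∃ c C : ℝ, 0 < c ∧ 0 < C ∧
      ∀ (n d : ℕ), 1 ≤ n → 1 ≤ d →
      ∀ (δ : ℝ), 0 < δ → δ ≤ 1 / 4 →
      ∀ (S : Matrix (Fin d) (Fin d) ℝ), S.PosDef →
        ENNReal.ofReal (c * MinimaxQuantile.gaussianRate n S δ) ≤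
          MinimaxQuantile.minimaxQuantile δ (MinimaxQuantile.gaussianModel n S)
            MinimaxQuantile.sqLoss ∧
        MinimaxQuantile.minimaxQuantile δ (MinimaxQuantile.gaussianModel n S)
            MinimaxQuantile.sqLoss ≤
          ENNReal.ofReal (C * MinimaxQuantile.gaussianRate n S δ) ∧
        MinimaxQuantile.worstQuantile δ (MinimaxQuantile.gaussianModel n S)
            MinimaxQuantile.sqLoss (MinimaxQuantile.sampleMean n) ≤
          ENNReal.ofReal (C * MinimaxQuantile.gaussianRate n S δ) := by
  refine ⟨1 / 512, 4, by norm_num, by norm_num, fun n d hn hd δ hδ hδ4 S hS => ?_⟩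
  have : Nonempty (Fin d) := ⟨⟨0, hd⟩⟩
  have hn0 : n ≠ 0 := Nat.one_le_iff_ne_zero.1 hn
  have hup := MinimaxQuantile.worstQuantile_sampleMean_le hn0 hS hδ (by linarith)
  refine ⟨MinimaxQuantile.ofReal_gaussianRate_le_minimaxQuantile hn0 hS hδ hδ4,
    (iInf₂_le (MinimaxQuantile.sampleMean n) ?_).trans hup, hup⟩
  simp_rw [funext MinimaxQuantile.sampleMean_eq_meanCLM]
  fun_prop
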